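/- Let $(H,d)$ be a CAT($-1$) space in which every geodesic segment extends to a bi-infinite geodesic, and let $\partial H$ be its geodesic boundary. For $p\in H$ let $(x\cdot y)_p=\frac12(d(x,p)+d(y,p)-d(x,y))$ be the Gromov product, extended to $\xi,\zeta\in\partial H$ by $(\xi\cdot\zeta)_p=\lim_{x\to\xi,\,y\to\zeta}(x\cdot y)_p\in[0,\infty]$, and put $\pi_p(\xi,\zeta)=e^{-(\xi\cdot\zeta)_p}$ (with $e^{-\infty}=0$). Let $SH$ be the set of bi-infinite unit speed geodesics $\gamma:\mathbb R\to H$, with endpoints $\gamma^{+},\gamma^{-}\in\partial H$, the metric $\operatorname{dist}(\gamma_1,\gamma_2)=\frac12\int_{-\infty}^{\infty}d(\gamma_1(t),\gamma_2(t))e^{-|t|}\,dt$ and the geodesic flow $(\mathsf g^s\gamma)(t)=\gamma(s+t)$. For $p,q\in H$ let $\Gamma_{p,q}$ be the set of $\gamma\in SH$ with $\gamma(0)=p$ and $\gamma(d(p,q))=q$. Assume that $H$ has bounded flip: there are constants $R_1,R_2>0$ such that for all $\zeta,\nu\in\partial H$ and $p\in H$ there are $\gamma_1,\gamma_2\in SH$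 with $\gamma_1^+=\zeta$, $\gamma_2^+=\nu$, $\gamma_1(0)=p=\gamma_2(0)$ and $$(\gamma_1^-\cdot\gamma_2^-)_p\ \ge\ R_1(\gamma_1^+\cdot\gamma_2^+)_p-R_2 .$$ Let $\Phi:SH\to\mathbb R$ be a bounded Hölder function (with some exponent $\beta\in(0,1]$, with respect to $\operatorname{dist}$) which is tempered: for all $p\ne q$ in $H$ and $\gamma_1,\gamma_2\in\Gamma_{p,q}$ one has $\Phi(\mathsf g^t\gamma_1)=\Phi(\mathsf g^t\gamma_2)$ for $0\le t\le d(p,q)$. Put $d^\Phi(p,q)=\int_0^{d(p,q)}\Phi(\mathsf g^t\gamma)\,dt$ for any $\gamma\in\Gamma_{p,q}$, with $d^\Phi(p,p)=0$. Then for all $p,q\in H$ and $\xi\in\partial H$ the limit $$\rho^\Phi_\xi(p,q)=\lim_{z\to\xi,\ z\in H}\bigl(d^\Phi(q,z)-d^\Phi(p,z)\bigr)$$ exists, and there are $\varepsilon>0$ and a constant $D_\Phi$, depending only on $H$ and $\Phi$, such that for all $p,q\in H$ $$\sup_{\zeta\neq\nu,\ \pi_p(\zeta,\nu)\le e^{-d(p,q)}}\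 \frac{|\rho^\Phi_\zeta(p,q)-\rho^\Phi_\nu(p,q)|}{\pi_p(\zeta,\nu)^{\varepsilon}}\ <\ D_\Phi\,e^{\varepsilon d(p,q)},$$ where the supremum over the empty set is $0$. -/

import Mathlib

open Filter Topology MeasureTheory
open scoped NNReal ENNReal

noncomputable section

namespace NegCurv

variable {H : Type*} [MetricSpace H]

/-- A metric space is CAT(-1) if any two points are joined by a geodesic segment and geodesic
triangles are at least as thin as their comparison triangles in the hyperbolic plane `UpperHalfPlane`
(of curvature -1). In a geodesic space, the points `a` with `dist x a + dist a y = dist x y`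
are exactly the points of the geodesic segments from `x` to `y`; any two distinct sides of a triangle
have a common vertex, called `x` below. -/
structure IsCATNegOne (H : Type*) [MetricSpace H] : Prop where
  exists_geodesic : ∀ x y : H, ∃ c : ℝ → H, c 0 = x ∧ c (dist x y) = y ∧
    ∀ s ∈ Set.Icc 0 (dist x y), ∀ t ∈ Set.Icc 0 (dist x y), dist (c s) (c t) = |s - t|
  comparison : ∀ x y z a b : H,
    dist x a + dist a y = dist x y → dist x b + dist b z = dist x z →
    ∀ x' y' z' a' b' : UpperHalfPlane,
      dist x' y' = dist x y → dist x' z' = dist x z → dist y' z' = dist y z →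
      dist x' a' = dist x a → dist a' y' = dist a y →
      dist x' b' = dist x b → dist b' z' = dist b z →
      dist a b ≤ dist a' b'

/-- Geodesic rays, parametrized by arc length. -/
def Ray (H : Type*) [MetricSpace H] : Type _ := {c : ℝ≥0 → H // Isometry c}

/-- Two rays are asymptotic if they stay at bounded distance from each other. -/
def asymptotic (H : Type*) [MetricSpace H] : Setoid (Ray H) where
  r c c' := ∃ C : ℝ, ∀ t, dist (c.1 t) (c'.1 t) ≤ C
  iseqv :=
    { refl := fun c => ⟨0, fun t => by simp⟩
      symm := fun ⟨C, h⟩ => ⟨C, fun t => by rw [dist_comm]; exact h t⟩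
      trans := fun ⟨C, h⟩ ⟨C', h'⟩ =>
        ⟨C + C', fun t => (dist_triangle _ _ _).trans (add_le_add (h t) (h' t))⟩ }

/-- The geodesic boundary `∂H`: asymptote classes of geodesic rays. -/
def Boundary (H : Type*) [MetricSpace H] : Type _ := Quotient (asymptotic H)

/-- The endpoint at infinity of a ray. -/
def Ray.endpoint (c : Ray H) : Boundary H := Quotient.mk (asymptotic H) c

/-- The trace on `H` of the neighbourhood filter of a boundary point `ξ` in the cone topology on
`H ∪ ∂H`. For a ray `c` ending at `ξ`, a basic neighbourhood consists of the `x` at distance more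
than `r` from `c 0` for which the point `y` of the segment from `c 0` to `x` at distance `r` from
`c 0` is `δ`-close to `c r`. -/
def nhdsBoundary (ξ : Boundary H) : Filter H :=
  ⨅ (c : Ray H) (_ : c.endpoint = ξ) (r : ℝ≥0) (δ : ℝ) (_ : 0 < δ),
    𝓟 {x : H | (r : ℝ) < dist (c.1 0) x ∧
      ∃ y : H, dist (c.1 0) y = r ∧ dist (c.1 0) y + dist y x = dist (c.1 0) x ∧
        dist y (c.1 r) < δ}

/-- The Gromov product `(x · y)_p` of points of `H`. -/
def gromovProd (p x y : H) : ℝ := (dist x p + dist y p - dist x y) / 2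

/-- The Gromov product `(ξ · ζ)_p` of boundary points: the limit of `(x · y)_p` as `x → ξ` and
`y → ζ`, with values in the extended reals (it is `⊤` for `ξ = ζ`). -/
def gromovProdBoundary (p : H) (ξ ζ : Boundary H) : EReal :=
  limUnder (nhdsBoundary ξ ×ˢ nhdsBoundary ζ)
    (fun z : H × H => ((gromovProd p z.1 z.2 : ℝ) : EReal))

/-- `π_p(ξ, ζ) = exp (-(ξ · ζ)_p)`, which is `0` for `ξ = ζ`. -/
def visualDist (p : H) (ξ ζ : Boundary H) : ℝ :=
  (EReal.exp (-gromovProdBoundary p ξ ζ)).toReal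

/-- The unit tangent space `SH`: bi-infinite geodesics, parametrized by arc length. -/
def UnitTangent (H : Type*) [MetricSpace H] : Type _ := {γ : ℝ → H // Isometry γ}

namespace UnitTangent

/-- The metric on `SH`. -/
def sdist (γ₁ γ₂ : UnitTangent H) : ℝ :=
  (1 / 2) * ∫ t : ℝ, dist (γ₁.1 t) (γ₂.1 t) * Real.exp (-|t|)

/-- The geodesic flow: `(flow s γ)(t) = γ(s + t)`. -/
def flow (s : ℝ) (γ : UnitTangent H) : UnitTangent H :=
  ⟨fun t => γ.1 (s + t), γ.2.comp (isometry_add_left s)⟩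

/-- The forward endpoint `γ⁺`. -/
def forward (γ : UnitTangent H) : Boundary H :=
  Ray.endpoint ⟨fun t => γ.1 t, γ.2.comp isometry_subtype_coe⟩

/-- The backward endpoint `γ⁻`. -/
def backward (γ : UnitTangent H) : Boundary H :=
  Ray.endpoint ⟨fun t => γ.1 (-t), γ.2.comp ((IsometryEquiv.neg ℝ).isometry.comp
    isometry_subtype_coe)⟩

/-- The set `Γ_{p,q}` of bi-infinite geodesics which are at `p` at time `0` and run through `q` at
time `d(p,q)`. -/
def through (p q : H) : Set (UnitTangent H) := {γ | γ.1 0 = p ∧ γ.1 (dist p q) = q}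

end UnitTangent

open UnitTangent

/-- Geodesic completeness: every geodesic segment extends to a bi-infinite geodesic. -/
def GeodesicallyComplete (H : Type*) [MetricSpace H] : Prop :=
  ∀ p q : H, p ≠ q → (through p q).Nonempty

/-- Bounded flip. -/
def BoundedFlip (H : Type*) [MetricSpace H] : Prop :=
  ∃ R₁ R₂ : ℝ, 0 < R₁ ∧ 0 < R₂ ∧ ∀ (ζ ν : Boundary H) (p : H),
    ∃ γ₁ γ₂ : UnitTangent H, γ₁.forward = ζ ∧ γ₂.forward = ν ∧ γ₁.1 0 = p ∧ γ₂.1 0 = p ∧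
      (R₁ : EReal) * gromovProdBoundary p γ₁.forward γ₂.forward - (R₂ : EReal)
        ≤ gromovProdBoundary p γ₁.backward γ₂.backward

/-- The class of bounded tempered Hölder functions on `SH`. -/
structure IsTemperedHolder (Φ : UnitTangent H → ℝ) : Prop where
  bounded : ∃ L : ℝ, ∀ γ, |Φ γ| ≤ L
  holder : ∃ K β : ℝ, 0 < β ∧ β ≤ 1 ∧ ∀ γ₁ γ₂, |Φ γ₁ - Φ γ₂| ≤ K * sdist γ₁ γ₂ ^ β
  tempered : ∀ p q : H, p ≠ q → ∀ γ₁ ∈ through p q, ∀ γ₂ ∈ through p q,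
    ∀ t ∈ Set.Icc 0 (dist p q), Φ (flow t γ₁) = Φ (flow t γ₂)

open Classical in
/-- `d^Φ(p,q)`, the integral of `Φ` along the segment from `p` to `q`. For tempered `Φ` it does not
depend on the geodesic chosen in `Γ_{p,q}`. -/
def phiDist (Φ : UnitTangent H → ℝ) (p q : H) : ℝ :=
  if h : (through p q).Nonempty then ∫ t in (0 : ℝ)..dist p q, Φ (flow t h.choose) else 0

/-- The `Φ`-Busemann function `ρ_ξ^Φ(p,q) = lim_{z → ξ} (d^Φ(q,z) - d^Φ(p,z))`. -/
def phiBusemann (Φ : UnitTangent H → ℝ) (ξ : Boundary H) (p q : H) : ℝ :=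
  limUnder (nhdsBoundary ξ) (fun z => phiDist Φ q z - phiDist Φ p z)

end NegCurv

end

noncomputable section

namespace NegCurv

/-! ### Polar coordinates in the hyperbolic plane -/

/-! Both claims come from one four point estimate inside `H`. Write `d = d(p,q)` and `T = (z·z')_p`.
If `T > d - 1`, then `d^Φ(q,z) - d^Φ(p,z)` and `d^Φ(q,z') - d^Φ(p,z')` differ by at most a constant
times `exp(-(ε/2)(T - d))`. Letting `z, z'` tend to the same `ξ` sends `T` to infinity, so the
differences are Cauchy; letting `z → ζ` and `z' → ν` gives the Hölder bound, because `π_p(ζ,ν) =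
exp(-T)` in the limit.

For the four point estimate, the segments from `p` and `q` to `z` and `z'` are cut near the middle
of the stretch they share. Initial pieces are compared in pairs at `p` and at `q`, final pieces at
`z` and at `z'`. Comparison with hyperbolic triangles makes segments from a common vertex
exponentially close before their Gromov product (`IsCATNegOne.dist_le_exp`). But `Φ` sees whole
bi-infinite geodesics, including a past that the segments do not control. Bounded flip provides
extensions with close pasts (`exists_sdist_flow_le`), and temperedness allows any extension to be
exchanged for these; Hölder continuity and integration then give
`IsTemperedHolder.exists_integralsClose`. Final pieces are handled by the same result for `Φ`
composed with the flip. The pieces fail to match in length only by a difference of distances, which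
`IsCATNegOne.abs_dist_quadrilateral_le` bounds. -/

theorem sinh_mul_cos_lt_cosh (r φ : ℝ) : Real.sinh r * Real.cos φ < Real.cosh r := by
  have h1 : |Real.sinh r * Real.cos φ| ≤ |Real.sinh r| := by
    rw [abs_mul]
    exact mul_le_of_le_one_right (abs_nonneg _) (Real.abs_cos_le_one φ)
  have h2 : |Real.sinh r| < Real.cosh r := by
    rw [← abs_of_pos (Real.cosh_pos r), ← sq_lt_sq, Real.cosh_sq]
    linarith
  exact (le_abs_self _).trans_lt (h1.trans_lt h2)

/-- The point of the upper half plane with polar coordinates `(r, φ)` around `i`. -/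
def polarPoint (r φ : ℝ) : UpperHalfPlane :=
  ⟨⟨Real.sinh r * Real.sin φ / (Real.cosh r - Real.sinh r * Real.cos φ),
    1 / (Real.cosh r - Real.sinh r * Real.cos φ)⟩,
    one_div_pos.2 (sub_pos.2 (sinh_mul_cos_lt_cosh r φ))⟩

/-- The hyperbolic law of cosines. -/
theorem cosh_dist_polarPoint (r φ s ψ : ℝ) :
    Real.cosh (dist (polarPoint r φ) (polarPoint s ψ)) =
      Real.cosh r * Real.cosh s - Real.sinh r * Real.sinh s * Real.cos (φ - ψ) := by
  have hD : 0 < Real.cosh r - Real.sinh r * Real.cos φ := sub_pos.2 (sinh_mul_cos_lt_cosh r φ)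
  have hE : 0 < Real.cosh s - Real.sinh s * Real.cos ψ := sub_pos.2 (sinh_mul_cos_lt_cosh s ψ)
  have h1 := Real.cosh_sq r
  have h2 := Real.cosh_sq s
  have h3 := Real.sin_sq_add_cos_sq φ
  have h4 := Real.sin_sq_add_cos_sq ψ
  rw [UpperHalfPlane.cosh_dist, Complex.dist_eq, ← Complex.normSq_eq_norm_sq,
    Complex.normSq_apply, Real.cos_sub]
  simp only [polarPoint, UpperHalfPlane.im, Complex.sub_re, Complex.sub_im]
  set D := Real.cosh r - Real.sinh r * Real.cos φ with hDdef
  set E := Real.cosh s - Real.sinh s * Real.cos ψ with hEdef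
  have k1 : (Real.sinh r * Real.sin φ) ^ 2 + 1 = D * (Real.cosh r + Real.sinh r * Real.cos φ) := by
    rw [hDdef]; linear_combination (Real.sinh r) ^ 2 * h3 - h1
  have k2 : (Real.sinh s * Real.sin ψ) ^ 2 + 1 = E * (Real.cosh s + Real.sinh s * Real.cos ψ) := by
    rw [hEdef]; linear_combination (Real.sinh s) ^ 2 * h4 - h2
  have k3 : D * (Real.cosh s + Real.sinh s * Real.cos ψ) +
      E * (Real.cosh r + Real.sinh r * Real.cos φ) =
      2 * (Real.cosh r * Real.cosh s - Real.sinh r * Real.sinh s * (Real.cos φ * Real.cos ψ)) := by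
    rw [hDdef, hEdef]; ring
  clear_value D E
  field_simp
  linear_combination E ^ 2 * k1 + D ^ 2 * k2 + D * E * k3

theorem dist_polarPoint_same_angle {r s : ℝ} (φ : ℝ) :
    dist (polarPoint r φ) (polarPoint s φ) = |r - s| := by
  have h : Real.cosh (dist (polarPoint r φ) (polarPoint s φ)) = Real.cosh |r - s| := by
    rw [cosh_dist_polarPoint, Real.cosh_abs, Real.cosh_sub, sub_self, Real.cos_zero, mul_one]
  exact Real.cosh_injOn dist_nonneg (abs_nonneg (r - s)) h

theorem dist_polarPoint_zero {r : ℝ} (hr : 0 ≤ r) (φ ψ : ℝ) :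
    dist (polarPoint 0 φ) (polarPoint r ψ) = r := by
  have h : Real.cosh (dist (polarPoint 0 φ) (polarPoint r ψ)) = Real.cosh r := by
    rw [cosh_dist_polarPoint]; simp
  exact Real.cosh_injOn dist_nonneg hr h

theorem sinh_sub_le {a T : ℝ} (hT : 0 ≤ T) : Real.sinh (a - T) ≤ Real.exp (-T) * Real.sinh a := by
  rw [Real.sinh_eq, Real.sinh_eq, neg_sub, Real.exp_sub, Real.exp_sub, Real.exp_neg, Real.exp_neg]
  have h1 : 1 ≤ Real.exp T := Real.one_le_exp hT
  have h2 := Real.exp_pos a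
  have h3 : (Real.exp T)⁻¹ ≤ Real.exp T := (inv_le_one_of_one_le₀ h1).trans h1
  have h4 := mul_le_mul_of_nonneg_right h3 (inv_pos.2 h2).le
  simp only [div_eq_mul_inv]
  linarith

theorem one_add_sq_half_le_cosh {x : ℝ} (hx : 0 ≤ x) : 1 + x ^ 2 / 2 ≤ Real.cosh x := by
  have h1 : Real.cosh x = 1 + 2 * Real.sinh (x / 2) ^ 2 := by
    have h := Real.cosh_two_mul (x / 2)
    rw [mul_div_cancel₀ x two_ne_zero, Real.cosh_sq] at h
    linarith
  have h2 : x / 2 ≤ Real.sinh (x / 2) := Real.self_le_sinh_iff.2 (by linarith)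
  nlinarith

/-- In a hyperbolic triangle, the two sides from a vertex stay exponentially close up to the Gromov
product. -/
theorem exists_comparison_points {a b c t : ℝ} (ha : 0 < a) (hb : 0 < b) (hab : |a - b| ≤ c)
    (hc : c ≤ a + b) (ht : 0 ≤ t) :
    ∃ θ : ℝ, dist (polarPoint a 0) (polarPoint b θ) = c ∧
      dist (polarPoint t 0) (polarPoint t θ) ≤ Real.exp (t - (a + b - c) / 2) := by
  have hsa : 0 < Real.sinh a := Real.sinh_pos_iff.2 ha
  have hsb : 0 < Real.sinh b := Real.sinh_pos_iff.2 hb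
  have hs : 0 < Real.sinh a * Real.sinh b := mul_pos hsa hsb
  have hc0 : 0 ≤ c := (abs_nonneg _).trans hab
  -- The cosine of the angle opposite `c`; the triangle inequalities put it in `[-1, 1]`.
  set k := (Real.cosh a * Real.cosh b - Real.cosh c) / (Real.sinh a * Real.sinh b) with hk
  have hk' : Real.sinh a * Real.sinh b * k = Real.cosh a * Real.cosh b - Real.cosh c := by
    rw [hk]; field_simp
  have hk1 : k ≤ 1 := by
    rw [hk, div_le_one hs]
    have h : Real.cosh (a - b) ≤ Real.cosh c := Real.cosh_le_cosh.2 (by rwa [abs_of_nonneg hc0])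
    rw [Real.cosh_sub] at h
    linarith
  have hk2 : -1 ≤ k := by
    rw [hk, le_div_iff₀ hs]
    have h : Real.cosh c ≤ Real.cosh (a + b) :=
      Real.cosh_le_cosh.2 (by rwa [abs_of_nonneg hc0, abs_of_nonneg (by linarith)])
    rw [Real.cosh_add] at h
    linarith
  refine ⟨Real.arccos k, ?_, ?_⟩
  · have h : Real.cosh (dist (polarPoint a 0) (polarPoint b (Real.arccos k))) = Real.cosh c := by
      rw [cosh_dist_polarPoint, zero_sub, Real.cos_neg, Real.cos_arccos hk2 hk1, hk']
      ring
    exact Real.cosh_injOn dist_nonneg hc0 h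
  · set T := (a + b - c) / 2 with hT
    have hT0 : 0 ≤ T := by rw [hT]; linarith
    have haT : 0 ≤ a - T := by rw [hT]; linarith [(abs_le.1 hab).1]
    have hbT : 0 ≤ b - T := by rw [hT]; linarith [(abs_le.1 hab).2]
    -- Half-angle formula: with `T` the Gromov product, `c = (a - T) + (b - T)` and `a - b = (a - T)
    -- - (b - T)`.
    have h1 : (1 - k) * (Real.sinh a * Real.sinh b) =
        2 * (Real.sinh (a - T) * Real.sinh (b - T)) := by
      have e1 : Real.cosh c = Real.cosh ((a - T) + (b - T)) := by congr 1; rw [hT]; ring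
      have e2 : Real.cosh (a - b) = Real.cosh ((a - T) - (b - T)) := by congr 1; ring
      rw [Real.cosh_add] at e1
      rw [Real.cosh_sub, Real.cosh_sub] at e2
      linear_combination e1 - e2 - hk'
    have h2 : Real.sinh (a - T) * Real.sinh (b - T) ≤
        (Real.exp (-T) * Real.sinh a) * (Real.exp (-T) * Real.sinh b) :=
      mul_le_mul (sinh_sub_le hT0) (sinh_sub_le hT0) (Real.sinh_nonneg_iff.2 hbT)
        (mul_nonneg (Real.exp_pos _).le hsa.le)
    have h3 : 1 - k ≤ 2 * Real.exp (-T) ^ 2 := by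
      refine le_of_mul_le_mul_right ?_ hs
      rw [h1]
      linarith
    have h4 : Real.sinh t ≤ Real.exp t / 2 := by
      rw [Real.sinh_eq]; linarith [Real.exp_pos (-t)]
    have h5 : 0 ≤ Real.sinh t := Real.sinh_nonneg_iff.2 ht
    have h6 : Real.sinh t ^ 2 ≤ (Real.exp t / 2) ^ 2 := pow_le_pow_left₀ h5 h4 2
    have h7 : Real.sinh t ^ 2 * (1 - k) ≤ (Real.exp t / 2) ^ 2 * (2 * Real.exp (-T) ^ 2) :=
      mul_le_mul h6 h3 (by linarith) (sq_nonneg _)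
    have h8 := one_add_sq_half_le_cosh
      (dist_nonneg (x := polarPoint t 0) (y := polarPoint t (Real.arccos k)))
    rw [cosh_dist_polarPoint, zero_sub, Real.cos_neg, Real.cos_arccos hk2 hk1] at h8
    have h9 : Real.exp (t - T) = Real.exp t * Real.exp (-T) := by
      rw [← Real.exp_add]; ring_nf
    refine le_of_sq_le_sq ?_ (Real.exp_pos _).le
    rw [h9, mul_pow]
    have := Real.cosh_sq t
    nlinarith

variable {H : Type*} [MetricSpace H]

/-! ### Gromov products -/

theorem gromovProd_comm (p x y : H) : gromovProd p x y = gromovProd p y x := by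
  simp only [gromovProd, dist_comm x y]; ring

theorem gromovProd_nonneg (p x y : H) : 0 ≤ gromovProd p x y := by
  have := dist_triangle_right x y p
  simp only [gromovProd]; linarith

theorem gromovProd_le_left (p x y : H) : gromovProd p x y ≤ dist p x := by
  have := dist_triangle p x y
  simp only [gromovProd, dist_comm _ p]; linarith

theorem gromovProd_le_right (p x y : H) : gromovProd p x y ≤ dist p y :=
  gromovProd_comm p x y ▸ gromovProd_le_left p y x

theorem gromovProd_add (p x y : H) : gromovProd p x y + gromovProd x p y = dist p x := by
  simp only [gromovProd, dist_comm x p, dist_comm y p, dist_comm y x]; ring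

theorem gromovProd_mono {o x y u v : H} (hu : dist o u + dist u x = dist o x)
    (hv : dist o v + dist v y = dist o y) : gromovProd o u v ≤ gromovProd o x y := by
  have h1 := dist_triangle4 x u v y
  simp only [gromovProd, dist_comm _ o, dist_comm x u] at *
  linarith

namespace IsCATNegOne

/-- Geodesics issuing from a common point stay exponentially close up to the Gromov product. -/
theorem dist_le_exp (hCAT : IsCATNegOne H) {o x y u v : H}
    (huv : dist o u = dist o v) (hu : dist o u + dist u x = dist o x)
    (hv : dist o v + dist v y = dist o y) :
    dist u v ≤ Real.exp (dist o u - gromovProd o x y) := by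
  rcases (dist_nonneg (x := o) (y := x)).eq_or_lt with ha | ha
  · have h : dist o u = 0 := le_antisymm (by linarith [dist_nonneg (x := u) (y := x)]) dist_nonneg
    have h' : dist o v = 0 := huv ▸ h
    rw [← dist_eq_zero.1 h, ← dist_eq_zero.1 h', dist_self]
    exact (Real.exp_pos _).le
  rcases (dist_nonneg (x := o) (y := y)).eq_or_lt with hb | hb
  · have h' : dist o v = 0 := le_antisymm (by linarith [dist_nonneg (x := v) (y := y)]) dist_nonneg
    have h : dist o u = 0 := huv.trans h'
    rw [← dist_eq_zero.1 h, ← dist_eq_zero.1 h', dist_self]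
    exact (Real.exp_pos _).le
  obtain ⟨θ, h1, h2⟩ := exists_comparison_points ha hb (c := dist x y) (t := dist o u)
    (by simpa only [dist_comm o] using abs_dist_sub_le x y o)
    (by simpa only [dist_comm o] using dist_triangle_right x y o) dist_nonneg
  have key := hCAT.comparison o x y u v hu hv (polarPoint 0 0) (polarPoint (dist o x) 0)
    (polarPoint (dist o y) θ) (polarPoint (dist o u) 0) (polarPoint (dist o v) θ)
    (dist_polarPoint_zero ha.le _ _) (dist_polarPoint_zero hb.le _ _) h1
    (dist_polarPoint_zero dist_nonneg _ _)
    (by rw [dist_polarPoint_same_angle, abs_sub_comm, ← hu, add_sub_cancel_left,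
      abs_of_nonneg dist_nonneg])
    (dist_polarPoint_zero dist_nonneg _ _)
    (by rw [dist_polarPoint_same_angle, abs_sub_comm, ← hv, add_sub_cancel_left,
      abs_of_nonneg dist_nonneg])
  rw [← huv] at key
  refine key.trans (h2.trans_eq ?_)
  simp only [gromovProd, dist_comm _ o]

theorem exists_point (hCAT : IsCATNegOne H) (x y : H) {t : ℝ} (h0 : 0 ≤ t) (h1 : t ≤ dist x y) :
    ∃ m : H, dist x m = t ∧ dist m y = dist x y - t := by
  obtain ⟨c, hc0, hc1, hc⟩ := hCAT.exists_geodesic x y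
  refine ⟨c t, ?_, ?_⟩
  · rw [← hc0, hc 0 ⟨le_rfl, dist_nonneg⟩ t ⟨h0, h1⟩, zero_sub, abs_neg, abs_of_nonneg h0]
  · conv_lhs => rw [← hc1]
    rw [hc t ⟨h0, h1⟩ _ ⟨dist_nonneg, le_rfl⟩, abs_sub_comm, abs_of_nonneg (by linarith)]

/-- The four point estimate for differences of distances. -/
theorem abs_dist_quadrilateral_le (hCAT : IsCATNegOne H) {p q z z' : H} {B : ℝ}
    (h1 : gromovProd p q z ≤ B) (h2 : gromovProd p q z' ≤ B) (hB : B ≤ gromovProd p z z') :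
    |(dist p z - dist q z) - (dist p z' - dist q z')| ≤
      3 * Real.exp (-(gromovProd p z z' - B) / 2) := by
  set T := gromovProd p z z' with hT
  have hB0 : 0 ≤ B := (gromovProd_nonneg p q z).trans h1
  set E := Real.exp (-(T - B) / 2) with hE
  -- The quantity is the excess `d(q,m) + d(m,w) - d(q,w)` at the point `m` of the segment from `p`
  -- to `w` halfway between `B` and `T`. It is nonnegative, so two such excesses differ by at most
  -- the length of the interval.
  have aux : ∀ w : H, gromovProd p q w ≤ B → T ≤ dist p w → ∀ m : H, dist p m = (T + B) / 2 →
      dist m w = dist p w - (T + B) / 2 →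
      dist p w - dist q w - ((T + B) / 2 - dist q m) ∈ Set.Icc 0 (2 * E) := by
    intro w hw hTw m hm hmw
    have e1 := gromovProd_add p w q
    rw [gromovProd_comm p w q] at e1
    obtain ⟨n, hn1, hn2⟩ := hCAT.exists_point w q (t := dist m w) dist_nonneg
      (by have := gromovProd_le_right w p q; linarith)
    have h3 : dist m n ≤ E := by
      refine (hCAT.dist_le_exp (o := w) (x := p) (y := q) (by rw [hn1, dist_comm])
        (by rw [dist_comm w m, dist_comm m p, hm, hmw, dist_comm w p]; ring)
        (by rw [hn1, hn2]; ring)).trans (Real.exp_le_exp.2 ?_)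
      rw [dist_comm w m]
      linarith
    have h4 := dist_triangle q m w
    have h5 := dist_triangle q n m
    rw [dist_comm n m, dist_comm q n, hn2, dist_comm w q] at h5
    constructor <;> linarith
  obtain ⟨m, hm1, hm2⟩ := hCAT.exists_point p z (t := (T + B) / 2) (by linarith)
    (by have := gromovProd_le_left p z z'; linarith)
  obtain ⟨m', hm1', hm2'⟩ := hCAT.exists_point p z' (t := (T + B) / 2) (by linarith)
    (by have := gromovProd_le_right p z z'; linarith)
  have k1 := aux z h1 (gromovProd_le_left p z z') m hm1 hm2
  have k2 := aux z' h2 (gromovProd_le_right p z z') m' hm1' hm2'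
  have k3 : dist m m' ≤ E := by
    refine (hCAT.dist_le_exp (x := z) (y := z') (hm1.trans hm1'.symm) (by rw [hm1, hm2]; ring)
      (by rw [hm1', hm2']; ring)).trans (Real.exp_le_exp.2 ?_)
    rw [hm1]; linarith
  have k4 := abs_le.1 ((abs_dist_sub_le m m' q).trans k3)
  simp only [dist_comm _ q] at k4
  rw [abs_le]
  constructor <;> linarith [k1.1, k1.2, k2.1, k2.2]

end IsCATNegOne

/-! ### Rays and the boundary -/

theorem Ray.dist_eq (c : Ray H) (s t : ℝ≥0) : dist (c.1 s) (c.1 t) = |(s : ℝ) - t| := by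
  rw [c.2.dist_eq, NNReal.dist_eq]

theorem Ray.dist_zero (c : Ray H) (t : ℝ≥0) : dist (c.1 0) (c.1 t) = t := by
  simp [c.dist_eq]

theorem Ray.dist_add (c : Ray H) {s t : ℝ≥0} (h : s ≤ t) :
    dist (c.1 0) (c.1 s) + dist (c.1 s) (c.1 t) = dist (c.1 0) (c.1 t) := by
  have h' : (s : ℝ) ≤ t := h
  rw [c.dist_zero, c.dist_zero, c.dist_eq, abs_sub_comm, abs_of_nonneg (by linarith)]
  ring

theorem Ray.gromovProd_mono {c c' : Ray H} (h0 : c.1 0 = c'.1 0) {s t s' t' : ℝ≥0} (h : s ≤ t)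
    (h' : s' ≤ t') :
    gromovProd (c.1 0) (c.1 s) (c'.1 s') ≤ gromovProd (c.1 0) (c.1 t) (c'.1 t') :=
  NegCurv.gromovProd_mono (c.dist_add h) (h0 ▸ c'.dist_add h')

/-- No order between `t` and `s`, `s'` is needed: both endpoints can be pushed out beyond `t`, which
only increases the Gromov product. -/
theorem Ray.dist_le_exp (hCAT : IsCATNegOne H) {c c' : Ray H} (h0 : c.1 0 = c'.1 0)
    (s s' t : ℝ≥0) :
    dist (c.1 t) (c'.1 t) ≤ Real.exp (t - gromovProd (c.1 0) (c.1 s) (c'.1 s')) := by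
  have h := hCAT.dist_le_exp (o := c.1 0) (x := c.1 (max s t)) (y := c'.1 (max s' t)) (u := c.1 t)
    (v := c'.1 t) (by rw [c.dist_zero, h0, c'.dist_zero]) (c.dist_add (le_max_right _ _))
    (by rw [h0]; exact c'.dist_add (le_max_right _ _))
  refine h.trans (Real.exp_le_exp.2 ?_)
  rw [c.dist_zero]
  have := Ray.gromovProd_mono h0 (le_max_left s t) (le_max_left s' t)
  linarith

/-- Rays are determined by their starting points and their endpoints. -/
theorem Ray.eq_of_endpoint_eq (hCAT : IsCATNegOne H) {c c' : Ray H} (h0 : c.1 0 = c'.1 0)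
    (h : c.endpoint = c'.endpoint) : c = c' := by
  obtain ⟨C, hC⟩ := Quotient.exact h
  refine Subtype.ext (funext fun s => dist_le_zero.1 ?_)
  -- The Gromov product of `c t` and `c' t` is at least `t - C / 2`, hence unbounded.
  have h1 : ∀ t : ℝ≥0, dist (c.1 s) (c'.1 s) ≤ Real.exp (s + C / 2 - t) := by
    intro t
    refine (Ray.dist_le_exp hCAT h0 t t s).trans (Real.exp_le_exp.2 ?_)
    have e1 := c.dist_zero t
    have e2 := c'.dist_zero t
    rw [dist_comm] at e1 e2
    rw [gromovProd, e1, h0, e2]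
    linarith [hC t]
  refine ge_of_tendsto' (x := (atTop : Filter ℝ≥0)) ?_ h1
  refine Real.tendsto_exp_atBot.comp (tendsto_atBot_add_const_left _ _ ?_)
  exact tendsto_neg_atTop_atBot.comp (NNReal.tendsto_coe_atTop.2 tendsto_id)

/-- A ray converges to its endpoint. -/
theorem Ray.tendsto_nhdsBoundary (hCAT : IsCATNegOne H) (c : Ray H) :
    Tendsto c.1 atTop (nhdsBoundary c.endpoint) := by
  simp only [nhdsBoundary, tendsto_iInf, tendsto_principal]
  intro c' hc' r δ hδ
  obtain ⟨C, hC⟩ := Quotient.exact hc'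
  have hlim : Tendsto (fun t : ℝ≥0 => (t : ℝ)) atTop atTop := NNReal.tendsto_coe_atTop.2 tendsto_id
  have hexp : Tendsto (fun t : ℝ≥0 => Real.exp (r + C - t)) atTop (𝓝 0) :=
    Real.tendsto_exp_atBot.comp (tendsto_atBot_add_const_left _ _
      (tendsto_neg_atTop_atBot.comp hlim))
  filter_upwards [hlim.eventually_gt_atTop (r + C), hexp.eventually_lt_const hδ,
    eventually_ge_atTop r] with t ht1 ht2 ht3
  have h1 : (t : ℝ) - C ≤ dist (c'.1 0) (c.1 t) := by
    have := dist_triangle_right (c'.1 0) (c'.1 t) (c.1 t)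
    rw [c'.dist_zero] at this
    linarith [hC t]
  obtain ⟨y, hy1, hy2⟩ := hCAT.exists_point (c'.1 0) (c.1 t) r.2 (by simp; linarith)
  have hy1' : dist (c'.1 0) y = r := hy1
  have hy2' : dist y (c.1 t) = dist (c'.1 0) (c.1 t) - r := hy2
  refine ⟨by linarith, y, hy1', by rw [hy1', hy2']; ring, lt_of_le_of_lt ?_ ht2⟩
  refine (hCAT.dist_le_exp (o := c'.1 0) (x := c.1 t) (y := c'.1 t)
    (by rw [hy1', c'.dist_zero]) (by rw [hy1', hy2']; ring) (c'.dist_add ht3)).trans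
    (Real.exp_le_exp.2 ?_)
  have e1 := c'.dist_zero t
  have := hC t
  rw [dist_comm] at e1 this
  rw [hy1', gromovProd, e1, dist_comm _ (c'.1 0)]
  linarith

theorem Ray.eventually_nhdsBoundary (c : Ray H) (r : ℝ≥0) {δ : ℝ} (hδ : 0 < δ) :
    ∀ᶠ x in nhdsBoundary c.endpoint, ∃ y : H, dist (c.1 0) y = r ∧
      dist (c.1 0) y + dist y x = dist (c.1 0) x ∧ dist y (c.1 r) < δ := by
  have h : {x : H | (r : ℝ) < dist (c.1 0) x ∧ ∃ y : H, dist (c.1 0) y = r ∧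
      dist (c.1 0) y + dist y x = dist (c.1 0) x ∧ dist y (c.1 r) < δ} ∈
      nhdsBoundary c.endpoint := by
    refine mem_iInf_of_mem c (mem_iInf_of_mem rfl (mem_iInf_of_mem r (mem_iInf_of_mem δ
      (mem_iInf_of_mem hδ (mem_principal_self _)))))
  filter_upwards [h] with x hx using hx.2

/-- Completeness of `H` is not assumed, so rays from `p` are not built as limits of segments;
bounded flip with both endpoints equal to `ξ` supplies them. -/
theorem BoundedFlip.exists_ray (hflip : BoundedFlip H) (p : H) (ξ : Boundary H) :
    ∃ c : Ray H, c.1 0 = p ∧ c.endpoint = ξ := by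
  obtain ⟨R₁, R₂, -, -, h⟩ := hflip
  obtain ⟨γ, -, h1, -, h2, -⟩ := h ξ ξ p
  exact ⟨_, h2, h1⟩

theorem nhdsBoundary_neBot (hCAT : IsCATNegOne H) (ξ : Boundary H) : (nhdsBoundary ξ).NeBot := by
  obtain ⟨c, rfl⟩ := Quotient.exists_rep ξ
  exact (c.tendsto_nhdsBoundary hCAT).neBot

/-! ### Gromov products of boundary points -/

/-- Segments towards points near `ξ` all pass within `1/2` of the ray at time `M + 1`, so two of
them have product at least `M + 1/2`. -/
theorem tendsto_gromovProd_self (hflip : BoundedFlip H) (p : H)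
    (ξ : Boundary H) :
    Tendsto (fun z : H × H => gromovProd p z.1 z.2) (nhdsBoundary ξ ×ˢ nhdsBoundary ξ) atTop := by
  obtain ⟨c, rfl, rfl⟩ := hflip.exists_ray p ξ
  refine tendsto_atTop.2 fun M => ?_
  have h := c.eventually_nhdsBoundary (M + 1).toNNReal one_half_pos
  filter_upwards [h.prod_mk h] with z hz
  obtain ⟨⟨y, hy1, hy2, hy3⟩, y', hy1', hy2', hy3'⟩ := hz
  refine le_trans ?_ (NegCurv.gromovProd_mono hy2 hy2')
  have h1 := dist_triangle_right y y' (c.1 (M + 1).toNNReal)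
  have h2 := Real.le_coe_toNNReal (M + 1)
  rw [gromovProd, dist_comm y, dist_comm y', hy1, hy1']
  linarith

/-- Rays with different endpoints are more than `2` apart at some time `t`. A product above `t`
would bring the segments within `1` of each other there, and each is within `1/2` of its ray. -/
theorem exists_eventually_gromovProd_le (hCAT : IsCATNegOne H) (hflip : BoundedFlip H) (p : H)
    {ξ ζ : Boundary H} (h : ξ ≠ ζ) :
    ∃ B : ℝ, ∀ᶠ z in nhdsBoundary ξ ×ˢ nhdsBoundary ζ, gromovProd p z.1 z.2 ≤ B := by
  obtain ⟨c, rfl, rfl⟩ := hflip.exists_ray p ξ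
  obtain ⟨c', h0, rfl⟩ := hflip.exists_ray (c.1 0) ζ
  obtain ⟨t, ht⟩ : ∃ t : ℝ≥0, 2 < dist (c.1 t) (c'.1 t) := by
    by_contra! hcon
    exact h (Quotient.sound ⟨2, hcon⟩)
  refine ⟨t, ?_⟩
  have h1 := c.eventually_nhdsBoundary t one_half_pos
  have h2 := c'.eventually_nhdsBoundary t one_half_pos
  rw [h0] at h2
  filter_upwards [h1.prod_mk h2] with z hz
  obtain ⟨⟨y, hy1, hy2, hy3⟩, y', hy1', hy2', hy3'⟩ := hz
  have h3 := hCAT.dist_le_exp (hy1.trans hy1'.symm) hy2 hy2'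
  by_contra! hcon
  have h4 : Real.exp (dist (c.1 0) y - gromovProd (c.1 0) z.1 z.2) ≤ 1 :=
    Real.exp_le_one_iff.2 (by rw [hy1]; linarith)
  have h5 := dist_triangle4 (c.1 t) y y' (c'.1 t)
  rw [dist_comm (c.1 t) y] at h5
  linarith

/-- Moving one argument of the Gromov product changes it by half a difference of distances, so the
four point estimate with the other argument as `q` gives a Cauchy bound; the arguments are moved one
after the other. -/
theorem exists_tendsto_gromovProd (hCAT : IsCATNegOne H) (hflip : BoundedFlip H) (p : H)
    {ξ ζ : Boundary H} (h : ξ ≠ ζ) :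
    ∃ T : ℝ, Tendsto (fun z : H × H => gromovProd p z.1 z.2)
      (nhdsBoundary ξ ×ˢ nhdsBoundary ζ) (𝓝 T) := by
  have := nhdsBoundary_neBot hCAT ξ
  have := nhdsBoundary_neBot hCAT ζ
  obtain ⟨B, hB⟩ := exists_eventually_gromovProd_le hCAT hflip p h
  have key : ∀ {z w u : H} {M : ℝ}, B ≤ M → M ≤ gromovProd p z w → gromovProd p u z ≤ B →
      gromovProd p u w ≤ B →
      |gromovProd p z u - gromovProd p w u| ≤ 3 * Real.exp (-(M - B) / 2) := by
    intro z w u M h1 h2 h3 h4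
    have h5 := hCAT.abs_dist_quadrilateral_le h3 h4 (h1.trans h2)
    have h6 : Real.exp (-(gromovProd p z w - B) / 2) ≤ Real.exp (-(M - B) / 2) :=
      Real.exp_le_exp.2 (by linarith)
    have h7 : gromovProd p z u - gromovProd p w u =
        ((dist p z - dist u z) - (dist p w - dist u w)) / 2 := by
      simp only [gromovProd, dist_comm z p, dist_comm w p, dist_comm z u, dist_comm w u]; ring
    rw [h7, abs_div, abs_two]
    linarith [abs_nonneg ((dist p z - dist u z) - (dist p w - dist u w))]
  refine CompleteSpace.complete (Metric.cauchy_iff.2 ⟨inferInstance, fun ε hε => ?_⟩)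
  obtain ⟨M, hM1, hM2⟩ : ∃ M, B ≤ M ∧ 6 * Real.exp (-(M - B) / 2) < ε := by
    have h1 : Tendsto (fun M : ℝ => 6 * Real.exp (-(M - B) / 2)) atTop (𝓝 (6 * 0)) := by
      refine (Real.tendsto_exp_atBot.comp ?_).const_mul 6
      refine Tendsto.atBot_div_const two_pos (tendsto_neg_atTop_atBot.comp ?_)
      exact tendsto_atTop_add_const_right _ _ tendsto_id
    rw [mul_zero] at h1
    exact ((eventually_ge_atTop B).and (h1.eventually_lt_const hε)).exists
  obtain ⟨U, hU, V, hV, hUV⟩ := mem_prod_iff.1 hB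
  obtain ⟨U₁, hU₁, hUU⟩ := mem_prod_same_iff.1
    ((tendsto_gromovProd_self hflip p ξ).eventually_ge_atTop M)
  obtain ⟨V₁, hV₁, hVV⟩ := mem_prod_same_iff.1
    ((tendsto_gromovProd_self hflip p ζ).eventually_ge_atTop M)
  refine ⟨(fun z : H × H => gromovProd p z.1 z.2) '' ((U ∩ U₁) ×ˢ (V ∩ V₁)),
    image_mem_map (prod_mem_prod (inter_mem hU hU₁) (inter_mem hV hV₁)), ?_⟩
  rintro _ ⟨⟨z, z'⟩, ⟨hz, hz'⟩, rfl⟩ _ ⟨⟨w, w'⟩, ⟨hw, hw'⟩, rfl⟩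
  have b1 : gromovProd p z z' ≤ B := hUV (Set.mk_mem_prod hz.1 hz'.1)
  have b2 : gromovProd p w z' ≤ B := hUV (Set.mk_mem_prod hw.1 hz'.1)
  have b3 : gromovProd p w w' ≤ B := hUV (Set.mk_mem_prod hw.1 hw'.1)
  have m1 : M ≤ gromovProd p z w := hUU (Set.mk_mem_prod hz.2 hw.2)
  have m2 : M ≤ gromovProd p z' w' := hVV (Set.mk_mem_prod hz'.2 hw'.2)
  have k1 := key hM1 m1 (gromovProd_comm p z' z ▸ b1) (gromovProd_comm p z' w ▸ b2)
  have k2 := key hM1 m2 b2 b3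
  rw [gromovProd_comm p z' w, gromovProd_comm p w' w] at k2
  have k3 := abs_sub_le (gromovProd p z z') (gromovProd p w z') (gromovProd p w w')
  rw [Real.dist_eq]
  change |gromovProd p z z' - gromovProd p w w'| < ε
  linarith

theorem tendsto_gromovProdBoundary (hCAT : IsCATNegOne H) (hflip : BoundedFlip H) (p : H)
    (ξ ζ : Boundary H) :
    Tendsto (fun z : H × H => ((gromovProd p z.1 z.2 : ℝ) : EReal))
      (nhdsBoundary ξ ×ˢ nhdsBoundary ζ) (𝓝 (gromovProdBoundary p ξ ζ)) := by
  refine tendsto_nhds_limUnder ?_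
  rcases eq_or_ne ξ ζ with rfl | h
  · exact ⟨⊤, EReal.tendsto_coe_atTop.comp (tendsto_gromovProd_self hflip p ξ)⟩
  · obtain ⟨T, hT⟩ := exists_tendsto_gromovProd hCAT hflip p h
    exact ⟨T, (continuous_coe_real_ereal.tendsto T).comp hT⟩

theorem gromovProd_le_gromovProdBoundary (hCAT : IsCATNegOne H) (hflip : BoundedFlip H)
    {c c' : Ray H} (h0 : c.1 0 = c'.1 0) (s s' : ℝ≥0) :
    ((gromovProd (c.1 0) (c.1 s) (c'.1 s') : ℝ) : EReal) ≤
      gromovProdBoundary (c.1 0) c.endpoint c'.endpoint := by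
  have h := (tendsto_gromovProdBoundary hCAT hflip (c.1 0) c.endpoint c'.endpoint).comp
    (((c.tendsto_nhdsBoundary hCAT).comp tendsto_id).prodMk
      ((c'.tendsto_nhdsBoundary hCAT).comp tendsto_id))
  refine ge_of_tendsto h ?_
  filter_upwards [eventually_ge_atTop s, eventually_ge_atTop s'] with t ht ht'
  exact EReal.coe_le_coe_iff.2 (Ray.gromovProd_mono h0 ht ht')

/-- A real lower bound `G` is used because the boundary product may be `⊤`. Every `G' < G` is
exceeded at a finite time, and then `G'` tends to `G`. -/
theorem dist_le_exp_sub_of_le_gromovProdBoundary (hCAT : IsCATNegOne H) (hflip : BoundedFlip H)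
    {c c' : Ray H} (h0 : c.1 0 = c'.1 0) {G : ℝ}
    (hG : (G : EReal) ≤ gromovProdBoundary (c.1 0) c.endpoint c'.endpoint) (t : ℝ≥0) :
    dist (c.1 t) (c'.1 t) ≤ Real.exp (t - G) := by
  have h := (tendsto_gromovProdBoundary hCAT hflip (c.1 0) c.endpoint c'.endpoint).comp
    (((c.tendsto_nhdsBoundary hCAT).comp tendsto_id).prodMk
      ((c'.tendsto_nhdsBoundary hCAT).comp tendsto_id))
  have h1 : ∀ G' < G, dist (c.1 t) (c'.1 t) ≤ Real.exp (t - G') := by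
    intro G' hG'
    obtain ⟨s, hs⟩ := (h.eventually_const_lt
      ((EReal.coe_lt_coe_iff.2 hG').trans_le hG)).exists
    refine (Ray.dist_le_exp hCAT h0 s s t).trans (Real.exp_le_exp.2 ?_)
    have : G' < gromovProd (c.1 0) (c.1 s) (c'.1 s) := EReal.coe_lt_coe_iff.1 hs
    linarith
  have h2 : Tendsto (fun G' : ℝ => Real.exp (t - G')) (𝓝[<] G) (𝓝 (Real.exp (t - G))) :=
    (Continuous.tendsto (by fun_prop) G).mono_left nhdsWithin_le_nhds
  exact ge_of_tendsto h2 (eventually_nhdsWithin_of_forall h1)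

/-! ### The unit tangent space -/

theorem integral_exp_neg_abs_div_four : ∫ s : ℝ, Real.exp (-|s| / 4) = 8 := by
  have h := integral_comp_abs (f := fun x => Real.exp ((-1 / 4) * x))
  have h2 := integral_exp_mul_Ioi (a := -1 / 4) (by norm_num) 0
  rw [h2] at h
  have h3 : (fun s : ℝ => Real.exp (-|s| / 4)) = fun s => Real.exp ((-1 / 4) * |s|) := by
    funext s; ring_nf
  rw [h3, h]
  norm_num

theorem integrable_exp_neg_abs_div_four : Integrable fun s : ℝ => Real.exp (-|s| / 4) := by
  by_contra h
  have := integral_exp_neg_abs_div_four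
  rw [integral_undef h] at this
  norm_num at this

namespace UnitTangent

theorem dist_apply (γ : UnitTangent H) (s t : ℝ) : dist (γ.1 s) (γ.1 t) = |s - t| := by
  rw [γ.2.dist_eq, Real.dist_eq]

theorem sdist_nonneg (γ₁ γ₂ : UnitTangent H) : 0 ≤ sdist γ₁ γ₂ :=
  mul_nonneg (by norm_num) (integral_nonneg fun _ => mul_nonneg dist_nonneg (Real.exp_pos _).le)

/-- Growth at rate `3/4` still leaves `exp (-|s| / 4)` against the weight, with integral `8`; the
factor `1/2` gives `4`. -/
theorem sdist_le {γ₁ γ₂ : UnitTangent H} {A : ℝ}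
    (h : ∀ s, dist (γ₁.1 s) (γ₂.1 s) ≤ A * Real.exp (3 * |s| / 4)) : sdist γ₁ γ₂ ≤ 4 * A := by
  have h1 : ∫ s : ℝ, dist (γ₁.1 s) (γ₂.1 s) * Real.exp (-|s|) ≤
      ∫ s : ℝ, A * Real.exp (-|s| / 4) := by
    refine integral_mono_of_nonneg
      (ae_of_all _ fun _ => mul_nonneg dist_nonneg (Real.exp_pos _).le)
      (integrable_exp_neg_abs_div_four.const_mul A) (ae_of_all _ fun s => ?_)
    refine (mul_le_mul_of_nonneg_right (h s) (Real.exp_pos _).le).trans_eq ?_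
    rw [mul_assoc, ← Real.exp_add]
    ring_nf
  rw [integral_const_mul, integral_exp_neg_abs_div_four] at h1
  rw [sdist]
  linarith

theorem sdist_flow_flow_le (γ : UnitTangent H) (s t : ℝ) :
    sdist (flow s γ) (flow t γ) ≤ 4 * |s - t| := by
  refine sdist_le fun u => ?_
  change dist (γ.1 (s + u)) (γ.1 (t + u)) ≤ _
  rw [dist_apply, add_sub_add_right_eq_sub]
  exact le_mul_of_one_le_right (abs_nonneg _) (Real.one_le_exp (by positivity))

theorem flow_flow (s t : ℝ) (γ : UnitTangent H) : flow s (flow t γ) = flow (t + s) γ :=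
  Subtype.ext (funext fun u => congrArg γ.1 (add_assoc t s u).symm)

/-- The flip of a bi-infinite geodesic. -/
def reverse (γ : UnitTangent H) : UnitTangent H :=
  ⟨fun t => γ.1 (-t), γ.2.comp (IsometryEquiv.neg ℝ).isometry⟩

theorem reverse_reverse (γ : UnitTangent H) : reverse (reverse γ) = γ :=
  Subtype.ext (funext fun t => congrArg γ.1 (neg_neg t))

theorem flow_reverse (s : ℝ) (γ : UnitTangent H) : flow s (reverse γ) = reverse (flow (-s) γ) :=
  Subtype.ext (funext fun t => congrArg γ.1 (neg_add s t))

theorem sdist_reverse (γ₁ γ₂ : UnitTangent H) :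
    sdist (reverse γ₁) (reverse γ₂) = sdist γ₁ γ₂ := by
  rw [sdist, sdist, ← integral_neg_eq_self]
  simp [reverse]

/-- A geodesic from `p` to `q`, turned into one from `q` to `p`. -/
def turn (d : ℝ) (γ : UnitTangent H) : UnitTangent H := flow (-d) (reverse γ)

theorem turn_mem_through {p q : H} {γ : UnitTangent H} (h : γ ∈ through p q) :
    turn (dist p q) γ ∈ through q p := by
  refine ⟨?_, ?_⟩
  · change γ.1 (-(-dist p q + 0)) = q
    rw [add_zero, neg_neg, h.2]
  · change γ.1 (-(-dist p q + dist q p)) = p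
    rw [dist_comm q p, neg_add_cancel, neg_zero, h.1]

/-- This expresses integrals of `Φ` over the final part of a segment as integrals of `Φ ∘ reverse`
starting at its endpoint. -/
theorem reverse_flow_turn (d t : ℝ) (γ : UnitTangent H) :
    reverse (flow t (turn d γ)) = flow (d - t) γ := by
  rw [turn, flow_flow, flow_reverse, reverse_reverse, neg_add, neg_neg, ← sub_eq_add_neg]

/-- The forward ray of a bi-infinite geodesic. -/
def ray (γ : UnitTangent H) : Ray H := ⟨fun t => γ.1 t, γ.2.comp isometry_subtype_coe⟩

theorem ray_zero (γ : UnitTangent H) : γ.ray.1 0 = γ.1 0 := by simp [ray]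

end UnitTangent

open UnitTangent

namespace IsTemperedHolder

theorem continuous_flow {Φ : UnitTangent H → ℝ} (hΦ : IsTemperedHolder Φ) (γ : UnitTangent H) :
    Continuous fun t => Φ (flow t γ) := by
  obtain ⟨K, β, hβ, -, h⟩ := hΦ.holder
  refine continuous_iff_continuousAt.2 fun s => tendsto_iff_dist_tendsto_zero.2 ?_
  have h1 : Tendsto (fun t : ℝ => |K| * (4 * |t - s|) ^ β) (𝓝 s) (𝓝 (|K| * (4 * |s - s|) ^ β)) := by
    refine Tendsto.const_mul _ (Tendsto.rpow_const ?_ (Or.inr hβ.le))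
    exact Continuous.tendsto (f := fun t : ℝ => 4 * |t - s|) (by fun_prop) s
  rw [sub_self, abs_zero, mul_zero, Real.zero_rpow hβ.ne', mul_zero] at h1
  refine squeeze_zero (fun _ => dist_nonneg) (fun t => ?_) h1
  rw [Real.dist_eq]
  exact (h _ _).trans (mul_le_mul (le_abs_self K)
    (Real.rpow_le_rpow (sdist_nonneg _ _) (sdist_flow_flow_le γ t s) hβ.le)
    (Real.rpow_nonneg (sdist_nonneg _ _) _) (abs_nonneg K))

theorem intervalIntegrable {Φ : UnitTangent H → ℝ} (hΦ : IsTemperedHolder Φ) (γ : UnitTangent H)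
    (a b : ℝ) : IntervalIntegrable (fun t => Φ (flow t γ)) volume a b :=
  (hΦ.continuous_flow γ).intervalIntegrable a b

/-- The class is invariant under the flip, so estimates at the initial point of a segment also apply
at its terminal point. -/
theorem comp_reverse {Φ : UnitTangent H → ℝ} (hΦ : IsTemperedHolder Φ) :
    IsTemperedHolder fun γ => Φ (reverse γ) := by
  refine ⟨?_, ?_, fun p q hpq γ₁ h₁ γ₂ h₂ t ht => ?_⟩
  · obtain ⟨L, hL⟩ := hΦ.bounded
    exact ⟨L, fun γ => hL _⟩
  · obtain ⟨K, β, h1, h2, h⟩ := hΦ.holder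
    refine ⟨K, β, h1, h2, fun γ₁ γ₂ => ?_⟩
    rw [← sdist_reverse γ₁ γ₂]
    exact h _ _
  · have h := hΦ.tempered q p hpq.symm _ (turn_mem_through h₁) _ (turn_mem_through h₂)
      (dist p q - t) (by rw [dist_comm q p]; constructor <;> linarith [ht.1, ht.2])
    have e : ∀ γ : UnitTangent H,
        flow (dist p q - t) (turn (dist p q) γ) = reverse (flow t γ) := by
      intro γ
      rw [← reverse_reverse (flow (dist p q - t) (turn (dist p q) γ)), reverse_flow_turn,
        sub_sub_cancel]
    rwa [e, e] at h

theorem phiDist_eq {Φ : UnitTangent H → ℝ} (hΦ : IsTemperedHolder Φ) {p q : H}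
    {γ : UnitTangent H} (h : γ ∈ through p q) :
    phiDist Φ p q = ∫ t in (0 : ℝ)..dist p q, Φ (flow t γ) := by
  have hne : (through p q).Nonempty := ⟨γ, h⟩
  rw [phiDist, dif_pos hne]
  rcases eq_or_ne p q with rfl | hpq
  · simp
  · refine intervalIntegral.integral_congr fun t ht => ?_
    rw [Set.uIcc_of_le dist_nonneg] at ht
    exact hΦ.tempered p q hpq _ hne.choose_spec _ h t ht

end IsTemperedHolder

theorem phiDist_self (Φ : UnitTangent H → ℝ) (p : H) : phiDist Φ p p = 0 := by
  rw [phiDist]; split_ifs <;> simp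

theorem abs_phiDist_le {Φ : UnitTangent H → ℝ} {L : ℝ} (hL0 : 0 ≤ L) (hL : ∀ γ, |Φ γ| ≤ L)
    (p q : H) : |phiDist Φ p q| ≤ L * dist p q := by
  rw [phiDist]
  split_ifs with h
  · refine (intervalIntegral.norm_integral_le_of_norm_le_const (C := L) fun t _ =>
      (Real.norm_eq_abs _).trans_le (hL _)).trans_eq ?_
    rw [sub_zero, abs_of_nonneg dist_nonneg]
  · rw [abs_zero]
    exact mul_nonneg hL0 dist_nonneg

/-- The integral along a segment is, up to the mismatch, the sum of the integral along an initial
part and the integral along a final part. -/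
theorem IsTemperedHolder.abs_phiDist_sub_le {Φ : UnitTangent H → ℝ} (hΦ : IsTemperedHolder Φ)
    {L : ℝ} (hL : ∀ γ, |Φ γ| ≤ L) {p q : H} {γ : UnitTangent H} (h : γ ∈ through p q) (τ σ : ℝ) :
    |phiDist Φ p q - ((∫ t in (0 : ℝ)..τ, Φ (flow t γ)) +
      ∫ t in (0 : ℝ)..σ, Φ (reverse (flow t (turn (dist p q) γ))))| ≤
      L * |dist p q - σ - τ| := by
  simp only [reverse_flow_turn]
  rw [intervalIntegral.integral_comp_sub_left (fun t => Φ (flow t γ)), sub_zero, hΦ.phiDist_eq h,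
    ← intervalIntegral.integral_add_adjacent_intervals (hΦ.intervalIntegrable γ 0 (dist p q - σ))
      (hΦ.intervalIntegrable γ (dist p q - σ) (dist p q)), add_sub_add_right_eq_sub,
    intervalIntegral.integral_interval_sub_left (hΦ.intervalIntegrable _ _ _)
      (hΦ.intervalIntegrable _ _ _)]
  exact intervalIntegral.norm_integral_le_of_norm_le_const fun t _ =>
    (Real.norm_eq_abs _).trans_le (hL _)

/-! ### Geodesics issuing from a common point -/

/-- A bound growing like `exp s` is not integrable against `exp (-|s|)`. Its geometric mean with the
linear bound is, at the price of the square root of the small factor `X ^ 2`. -/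
theorem le_two_mul_exp_of_le {D X s : ℝ} (hX : 0 < X)
    (h1 : D ≤ 1 + 2 * s) (h2 : D ≤ Real.exp s * X ^ 2) (hD : 0 ≤ D) :
    D ≤ 2 * X * Real.exp (3 * s / 4) := by
  refine le_of_sq_le_sq ?_ (by positivity)
  have h3 : 1 + 2 * s ≤ 4 * Real.exp (s / 2) := by linarith [Real.add_one_le_exp (s / 2)]
  have e : Real.exp (3 * s / 4) ^ 2 = Real.exp (s / 2) * Real.exp s := by
    rw [← Real.exp_nat_mul, ← Real.exp_add]; congr 1; push_cast; ring
  calc D ^ 2 = D * D := sq D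
    _ ≤ (4 * Real.exp (s / 2)) * (Real.exp s * X ^ 2) :=
        mul_le_mul (h1.trans h3) h2 hD (by positivity)
    _ = (2 * X * Real.exp (3 * s / 4)) ^ 2 := by rw [mul_pow, mul_pow, e]; ring

/-- Bounded flip provides extensions of two segments issuing from a common point which are close in
`SH` up to the Gromov product. -/
theorem exists_sdist_flow_le (hCAT : IsCATNegOne H) (hcomplete : GeodesicallyComplete H)
    (hflip : BoundedFlip H) :
    ∃ c A : ℝ, 0 < c ∧ 0 ≤ A ∧ ∀ o x y : H, o ≠ x → o ≠ y →
      ∃ γ₁ ∈ through o x, ∃ γ₂ ∈ through o y, ∀ t ∈ Set.Icc 0 (gromovProd o x y),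
        sdist (flow t γ₁) (flow t γ₂) ≤ A * Real.exp (-(c * (gromovProd o x y - t))) := by
  obtain ⟨R₁, R₂, hR₁, hR₂, hR⟩ := id hflip
  refine ⟨min R₁ 1 / 2, 4 * (2 * (1 + Real.exp (R₂ / 2))), by positivity, by positivity,
    fun o x y hox hoy => ?_⟩
  obtain ⟨α₁, hα₁⟩ := hcomplete o x hox
  obtain ⟨α₂, hα₂⟩ := hcomplete o y hoy
  obtain ⟨γ₁, γ₂, hf₁, hf₂, h₁, h₂, hb⟩ := hR α₁.forward α₂.forward o
  -- The flip condition prescribes endpoints only; uniqueness of rays forces its geodesics through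
  -- `x` and `y`.
  have hray : ∀ {γ α : UnitTangent H} {w : H}, γ.forward = α.forward → γ.1 0 = o →
      α ∈ through o w → γ.1 (dist o w) = w := by
    intro γ α w hf h0 hα
    have h := Ray.eq_of_endpoint_eq hCAT (c := γ.ray) (c' := α.ray)
      (by rw [ray_zero, ray_zero, h0, hα.1]) hf
    have h' := congrFun (congrArg Subtype.val h) (nndist o w)
    exact h'.trans hα.2
  have hw₁ := hray hf₁ h₁ hα₁
  have hw₂ := hray hf₂ h₂ hα₂
  refine ⟨γ₁, ⟨h₁, hw₁⟩, γ₂, ⟨h₂, hw₂⟩, fun t ht => ?_⟩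
  set T := gromovProd o x y with hT
  have hfwd : ((T : ℝ) : EReal) ≤ gromovProdBoundary o γ₁.forward γ₂.forward := by
    have h := gromovProd_le_gromovProdBoundary hCAT hflip (c := γ₁.ray) (c' := γ₂.ray)
      (by rw [ray_zero, ray_zero, h₁, h₂]) (nndist o x) (nndist o y)
    rw [ray_zero, h₁] at h
    change ((gromovProd o (γ₁.1 (dist o x)) (γ₂.1 (dist o y)) : ℝ) : EReal) ≤ _ at h
    rwa [hw₁, hw₂] at h
  have hbwd : ((R₁ * T - R₂ : ℝ) : EReal) ≤ gromovProdBoundary o γ₁.backward γ₂.backward := by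
    refine le_trans ?_ hb
    rw [EReal.coe_sub, EReal.coe_mul]
    exact EReal.sub_le_sub (mul_le_mul_of_nonneg_left hfwd (EReal.coe_nonneg.2 hR₁.le)) le_rfl
  have d1 : ∀ s : ℝ, 0 ≤ s → dist (γ₁.1 s) (γ₂.1 s) ≤ Real.exp (s - T) := by
    intro s hs
    lift s to ℝ≥0 using hs
    exact dist_le_exp_sub_of_le_gromovProdBoundary hCAT hflip (c := γ₁.ray) (c' := γ₂.ray)
      (by rw [ray_zero, ray_zero, h₁, h₂]) (by rw [ray_zero, h₁]; exact hfwd) s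
  have d2 : ∀ s : ℝ, 0 ≤ s → dist (γ₁.1 (-s)) (γ₂.1 (-s)) ≤ Real.exp (s - (R₁ * T - R₂)) := by
    intro s hs
    lift s to ℝ≥0 using hs
    have e : ∀ {γ : UnitTangent H}, γ.1 0 = o → γ.reverse.ray.1 0 = o := by
      intro γ hγ
      rw [ray_zero]
      change γ.1 (-0) = o
      rwa [neg_zero]
    exact dist_le_exp_sub_of_le_gromovProdBoundary hCAT hflip (c := γ₁.reverse.ray)
      (c' := γ₂.reverse.ray) (by rw [e h₁, e h₂]) (by rw [e h₁]; exact hbwd) s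
  have d3 : ∀ s u : ℝ, dist (γ₁.1 s) (γ₂.1 s) ≤ dist (γ₁.1 u) (γ₂.1 u) + 2 * |s - u| := by
    intro s u
    have := dist_triangle4 (γ₁.1 s) (γ₁.1 u) (γ₂.1 u) (γ₂.1 s)
    rw [dist_apply, dist_apply, abs_sub_comm u s] at this
    linarith
  have hT0 : 0 ≤ T := ht.1.trans ht.2
  have htT : 0 ≤ T - t := sub_nonneg.2 ht.2
  set E := Real.exp (-(min R₁ 1 / 2 * (T - t))) with hE
  have hc1 : min R₁ 1 / 2 ≤ 1 / 2 := by linarith [min_le_right R₁ 1]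
  have hc2 : min R₁ 1 / 2 ≤ R₁ / 2 := by linarith [min_le_left R₁ 1]
  have hc0 : 0 ≤ min R₁ 1 / 2 := by positivity
  have hE1 : Real.exp (-(T - t) / 2) ≤ E := by
    refine Real.exp_le_exp.2 ?_
    have := mul_le_mul_of_nonneg_right hc1 htT
    linarith
  have hE2 : Real.exp (-(R₁ * T - R₂) / 2) ≤ Real.exp (R₂ / 2) * E := by
    rw [hE, ← Real.exp_add]
    refine Real.exp_le_exp.2 ?_
    have h1 := mul_le_mul_of_nonneg_right hc2 hT0
    have h2 := mul_nonneg hc0 ht.1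
    linarith
  have hEpos : 0 < E := Real.exp_pos _
  have hR₂pos : 0 < Real.exp (R₂ / 2) := Real.exp_pos _
  rw [mul_assoc]
  refine sdist_le fun s => ?_
  change dist (γ₁.1 (t + s)) (γ₂.1 (t + s)) ≤ _
  -- Three ranges of the time `t + s`: after `t`, between `0` and `t`, and before `0`. Forward
  -- closeness settles the first two, the flip the last; interpolation is needed only in the outer
  -- two.
  rcases le_total 0 s with hs | hs
  · have k1 : dist (γ₁.1 (t + s)) (γ₂.1 (t + s)) ≤ 1 + 2 * s := by
      have := d3 (t + s) t
      rw [add_sub_cancel_left, abs_of_nonneg hs] at this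
      have h5 : Real.exp (t - T) ≤ 1 := Real.exp_le_one_iff.2 (by linarith)
      linarith [d1 t ht.1]
    have k2 : dist (γ₁.1 (t + s)) (γ₂.1 (t + s)) ≤
        Real.exp s * Real.exp (-(T - t) / 2) ^ 2 := by
      refine (d1 (t + s) (add_nonneg ht.1 hs)).trans_eq ?_
      rw [← Real.exp_nat_mul, ← Real.exp_add]
      congr 1; push_cast; ring
    refine (le_two_mul_exp_of_le (Real.exp_pos _) k1 k2 dist_nonneg).trans ?_
    rw [abs_of_nonneg hs]
    gcongr
    nlinarith
  rcases le_total (-t) s with hs' | hs'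
  · refine (d1 (t + s) (by linarith)).trans ?_
    have k1 : Real.exp (t + s - T) ≤ E :=
      (Real.exp_le_exp.2 (by linarith)).trans hE1
    have k2 : 1 ≤ Real.exp (3 * |s| / 4) := Real.one_le_exp (by positivity)
    have k3 : E * 1 ≤ (2 * (1 + Real.exp (R₂ / 2)) * E) * Real.exp (3 * |s| / 4) :=
      mul_le_mul (by nlinarith) k2 zero_le_one (by positivity)
    linarith
  · have hu : 0 ≤ -(t + s) := by linarith
    have k1 : dist (γ₁.1 (t + s)) (γ₂.1 (t + s)) ≤ 1 + 2 * -(t + s) := by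
      have := d3 (t + s) 0
      rw [h₁, h₂, dist_self, sub_zero, abs_of_nonpos (by linarith : t + s ≤ 0)] at this
      linarith
    have k2 : dist (γ₁.1 (t + s)) (γ₂.1 (t + s)) ≤
        Real.exp (-(t + s)) * Real.exp (-(R₁ * T - R₂) / 2) ^ 2 := by
      have := d2 (-(t + s)) hu
      rw [neg_neg] at this
      refine this.trans_eq ?_
      rw [← Real.exp_nat_mul, ← Real.exp_add]
      congr 1; push_cast; ring
    refine (le_two_mul_exp_of_le (Real.exp_pos _) k1 k2 dist_nonneg).trans ?_
    rw [abs_of_nonpos hs]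
    refine mul_le_mul ?_ (Real.exp_le_exp.2 (by linarith [ht.1])) (Real.exp_pos _).le (by positivity)
    linarith

/-- Integrals of `Φ` along segments issuing from a common point are exponentially close up to the
Gromov product. -/
def IntegralsClose (Φ : UnitTangent H → ℝ) (ε C : ℝ) : Prop :=
  ∀ o x y : H, o ≠ x → o ≠ y → ∀ γ₁ ∈ through o x, ∀ γ₂ ∈ through o y,
    ∀ τ ∈ Set.Icc 0 (gromovProd o x y),
      |(∫ t in (0 : ℝ)..τ, Φ (flow t γ₁)) - ∫ t in (0 : ℝ)..τ, Φ (flow t γ₂)| ≤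
        C * Real.exp (-(ε * (gromovProd o x y - τ)))

theorem IntegralsClose.mono {Φ : UnitTangent H → ℝ} {ε ε' C C' : ℝ} (h : IntegralsClose Φ ε C)
    (hε : ε' ≤ ε) (hC : C ≤ C') (hC' : 0 ≤ C') : IntegralsClose Φ ε' C' := by
  intro o x y hox hoy γ₁ h₁ γ₂ h₂ τ hτ
  refine (h o x y hox hoy γ₁ h₁ γ₂ h₂ τ hτ).trans ?_
  refine mul_le_mul hC (Real.exp_le_exp.2 (neg_le_neg ?_)) (Real.exp_pos _).le hC'
  exact mul_le_mul_of_nonneg_right hε (sub_nonneg.2 hτ.2)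

theorem integral_exp_neg_mul_sub_le {ε T τ : ℝ} (hε : 0 < ε) :
    ∫ t in (0 : ℝ)..τ, Real.exp (-(ε * (T - t))) ≤ Real.exp (-(ε * (T - τ))) / ε := by
  have h : ∀ t ∈ Set.uIcc 0 τ, HasDerivAt (fun t => Real.exp (-(ε * (T - t))) / ε)
      (Real.exp (-(ε * (T - t)))) t := by
    intro t _
    have h1 : HasDerivAt (fun t => -(ε * (T - t))) ε t := by
      have := (((hasDerivAt_id' t).const_sub T).const_mul ε).fun_neg
      rwa [mul_neg_one, neg_neg] at this
    have := h1.exp.div_const ε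
    rwa [mul_div_cancel_right₀ _ hε.ne'] at this
  rw [intervalIntegral.integral_eq_sub_of_hasDerivAt h
    (Continuous.intervalIntegrable (by fun_prop) _ _)]
  have : 0 ≤ Real.exp (-(ε * (T - 0))) / ε := by positivity
  linarith

/-- Closeness in `SH` at rate `c` becomes closeness of `Φ` at rate `c * β`, and integrating up to
`τ` costs only a factor `1 / (c * β)`. -/
theorem IsTemperedHolder.exists_integralsClose (hCAT : IsCATNegOne H)
    (hcomplete : GeodesicallyComplete H) (hflip : BoundedFlip H) {Φ : UnitTangent H → ℝ}
    (hΦ : IsTemperedHolder Φ) : ∃ ε C : ℝ, 0 < ε ∧ 0 ≤ C ∧ IntegralsClose Φ ε C := by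
  obtain ⟨c, A, hc, hA, hcA⟩ := exists_sdist_flow_le hCAT hcomplete hflip
  obtain ⟨K, β, hβ, -, hK⟩ := hΦ.holder
  refine ⟨c * β, |K| * A ^ β / (c * β), by positivity, by positivity,
    fun o x y hox hoy γ₁ h₁ γ₂ h₂ τ hτ => ?_⟩
  obtain ⟨α₁, hα₁, α₂, hα₂, hα⟩ := hcA o x y hox hoy
  set T := gromovProd o x y with hT
  have hb : ∀ t ∈ Set.Icc 0 τ, |Φ (flow t γ₁) - Φ (flow t γ₂)| ≤
      |K| * A ^ β * Real.exp (-(c * β * (T - t))) := by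
    intro t ht
    have htT : t ≤ T := ht.2.trans hτ.2
    -- Temperedness replaces the given extensions by the ones from bounded flip; `t` lies within
    -- both segments because `T` is at most either length.
    rw [hΦ.tempered o x hox γ₁ h₁ α₁ hα₁ t ⟨ht.1, htT.trans (gromovProd_le_left o x y)⟩,
      hΦ.tempered o y hoy γ₂ h₂ α₂ hα₂ t ⟨ht.1, htT.trans (gromovProd_le_right o x y)⟩]
    refine (hK _ _).trans ?_
    have h1 := Real.rpow_le_rpow (sdist_nonneg _ _) (hα t ⟨ht.1, htT⟩) hβ.le
    rw [Real.mul_rpow hA (Real.exp_pos _).le, ← Real.exp_mul] at h1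
    calc K * sdist (flow t α₁) (flow t α₂) ^ β
        ≤ |K| * sdist (flow t α₁) (flow t α₂) ^ β :=
          mul_le_mul_of_nonneg_right (le_abs_self K) (Real.rpow_nonneg (sdist_nonneg _ _) _)
      _ ≤ |K| * (A ^ β * Real.exp (-(c * (T - t)) * β)) :=
          mul_le_mul_of_nonneg_left h1 (abs_nonneg K)
      _ = |K| * A ^ β * Real.exp (-(c * β * (T - t))) := by rw [mul_assoc]; ring_nf
  rw [← intervalIntegral.integral_sub (hΦ.intervalIntegrable γ₁ 0 τ)
    (hΦ.intervalIntegrable γ₂ 0 τ)]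
  have h2 := intervalIntegral.norm_integral_le_of_norm_le (μ := volume)
    (f := fun t => Φ (flow t γ₁) - Φ (flow t γ₂))
    (g := fun t => |K| * A ^ β * Real.exp (-(c * β * (T - t)))) hτ.1
    (ae_of_all _ fun t ht => hb t ⟨ht.1.le, ht.2⟩)
    (Continuous.intervalIntegrable (by fun_prop) _ _)
  rw [intervalIntegral.integral_const_mul] at h2
  refine h2.trans ((mul_le_mul_of_nonneg_left
    (integral_exp_neg_mul_sub_le (mul_pos hc hβ)) (by positivity)).trans_eq ?_)
  ring

/-! ### The four point estimate for `phiDist` -/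

/-- The bounds on a tempered Hölder function from which the four point estimate follows. -/
structure HasIntegralBounds (Φ : UnitTangent H → ℝ) (ε C L : ℝ) : Prop where
  eps_pos : 0 < ε
  eps_le : ε ≤ 1
  C_nonneg : 0 ≤ C
  L_nonneg : 0 ≤ L
  bounded : ∀ γ, |Φ γ| ≤ L
  close : IntegralsClose Φ ε C
  close_reverse : IntegralsClose (fun γ => Φ (reverse γ)) ε C

theorem IsTemperedHolder.exists_hasIntegralBounds (hCAT : IsCATNegOne H)
    (hcomplete : GeodesicallyComplete H) (hflip : BoundedFlip H) {Φ : UnitTangent H → ℝ}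
    (hΦ : IsTemperedHolder Φ) : ∃ ε C L : ℝ, HasIntegralBounds Φ ε C L := by
  obtain ⟨ε, C, hε, hC, h⟩ := hΦ.exists_integralsClose hCAT hcomplete hflip
  obtain ⟨ε', C', hε', hC', h'⟩ := hΦ.comp_reverse.exists_integralsClose hCAT hcomplete hflip
  obtain ⟨L, hL⟩ := hΦ.bounded
  have hm : 0 ≤ max C C' := hC.trans (le_max_left _ _)
  -- The cap `1` makes the metric error, of rate `1/2`, no larger than one of rate `ε / 2`.
  exact ⟨min (min ε ε') 1, max C C', |L|, by positivity, min_le_right _ _, hm, abs_nonneg L,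
    fun γ => (hL γ).trans (le_abs_self L),
    h.mono ((min_le_left _ _).trans (min_le_left _ _)) (le_max_left _ _) hm,
    h'.mono ((min_le_left _ _).trans (min_le_right _ _)) (le_max_right _ _) hm⟩

/-- Seen from `z`, the segments to `p` and `q` are compared up to their full Gromov product, at cost
`C`; each leftover piece has length at most `d(p,q) ≤ 1` and costs at most `L`. -/
theorem HasIntegralBounds.abs_phiDist_sub_phiDist_le {Φ : UnitTangent H → ℝ}
    {ε C L : ℝ} (hcomplete : GeodesicallyComplete H) (hΦ : IsTemperedHolder Φ)
    (h : HasIntegralBounds Φ ε C L) {p q : H}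
    (hpq : dist p q ≤ 1) (z : H) : |phiDist Φ q z - phiDist Φ p z| ≤ C + 2 * L := by
  have hC := h.C_nonneg
  have hL := h.L_nonneg
  have h1 : L * dist p q ≤ L * 1 := mul_le_mul_of_nonneg_left hpq hL
  rcases eq_or_ne p z with rfl | hpz
  · rw [phiDist_self, sub_zero]
    have := abs_phiDist_le hL h.bounded q p
    rw [dist_comm] at this
    linarith
  rcases eq_or_ne q z with rfl | hqz
  · rw [phiDist_self, zero_sub, abs_neg]
    have := abs_phiDist_le hL h.bounded p q
    linarith
  obtain ⟨γ₁, h₁⟩ := hcomplete p z hpz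
  obtain ⟨γ₂, h₂⟩ := hcomplete q z hqz
  have k := h.close_reverse z p q hpz.symm hqz.symm _ (turn_mem_through h₁) _
    (turn_mem_through h₂) _ ⟨gromovProd_nonneg z p q, le_rfl⟩
  have k1 := hΦ.abs_phiDist_sub_le h.bounded h₁ 0 (gromovProd z p q)
  have k2 := hΦ.abs_phiDist_sub_le h.bounded h₂ 0 (gromovProd z p q)
  rw [intervalIntegral.integral_same, zero_add, sub_zero] at k1 k2
  rw [sub_self, mul_zero, neg_zero, Real.exp_zero, mul_one] at k
  have m1 : |dist p z - gromovProd z p q| ≤ 1 := by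
    have e := gromovProd_add p z q
    have e2 := gromovProd_le_right p z q
    rw [abs_of_nonneg] <;> linarith [gromovProd_nonneg p z q]
  have m2 : |dist q z - gromovProd z p q| ≤ 1 := by
    have e := gromovProd_add q z p
    have e2 := gromovProd_le_right q z p
    rw [gromovProd_comm z q p] at e
    rw [dist_comm q p] at e2
    rw [abs_of_nonneg] <;> linarith [gromovProd_nonneg q z p]
  have n1 := mul_le_mul_of_nonneg_left m1 hL
  have n2 := mul_le_mul_of_nonneg_left m2 hL
  have a1 := abs_le.1 k
  have a2 := abs_le.1 k1
  have a3 := abs_le.1 k2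
  rw [abs_le]
  constructor <;> linarith [a1.1, a1.2, a2.1, a2.2, a3.1, a3.2]

/-- The four point estimate. -/
theorem HasIntegralBounds.abs_quadrilateral_le (hCAT : IsCATNegOne H)
    (hcomplete : GeodesicallyComplete H) {Φ : UnitTangent H → ℝ} (hΦ : IsTemperedHolder Φ)
    {ε C L : ℝ} (h : HasIntegralBounds Φ ε C L) {p q z z' : H}
    (hT : dist p q < gromovProd p z z') :
    |(phiDist Φ q z - phiDist Φ p z) - (phiDist Φ q z' - phiDist Φ p z')| ≤
      (4 * C + 3 * L) * Real.exp (-(ε / 2 * (gromovProd p z z' - dist p q))) := by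
  have hC := h.C_nonneg
  have hL := h.L_nonneg
  set d := dist p q with hd
  set T := gromovProd p z z' with hTdef
  have hd0 : 0 ≤ d := dist_nonneg
  set E := Real.exp (-(ε / 2 * (T - d))) with hE
  have hTz : T ≤ dist p z := gromovProd_le_left p z z'
  have hTz' : T ≤ dist p z' := gromovProd_le_right p z z'
  have hpz : p ≠ z := dist_pos.1 (by linarith)
  have hpz' : p ≠ z' := dist_pos.1 (by linarith)
  -- The midpoint leaves each of the four comparisons a margin of at least `(T - d) / 2` before its
  -- Gromov product.
  set τ := (T + d) / 2 with hτ
  set S := gromovProd q z z' with hS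
  have hSe : S = T + ((dist q z - dist p z) + (dist q z' - dist p z')) / 2 := by
    simp only [hS, hTdef, gromovProd, dist_comm _ p, dist_comm _ q]
    ring
  have t1 := dist_triangle p q z
  have t2 := dist_triangle p q z'
  have hqz : q ≠ z := dist_pos.1 (by have := gromovProd_le_left q z z'; linarith)
  have hqz' : q ≠ z' := dist_pos.1 (by have := gromovProd_le_right q z z'; linarith)
  obtain ⟨γ₁, h₁⟩ := hcomplete p z hpz
  obtain ⟨γ₂, h₂⟩ := hcomplete p z' hpz'
  obtain ⟨γ₃, h₃⟩ := hcomplete q z hqz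
  obtain ⟨γ₄, h₄⟩ := hcomplete q z' hqz'
  have hexp : ∀ {X : ℝ}, (T - d) / 2 ≤ X → C * Real.exp (-(ε * X)) ≤ C * E := by
    intro X hX
    refine mul_le_mul_of_nonneg_left (Real.exp_le_exp.2 ?_) hC
    have := mul_le_mul_of_nonneg_left hX h.eps_pos.le
    linarith
  have kp := (h.close p z z' hpz hpz' _ h₁ _ h₂ τ ⟨by linarith, by linarith⟩).trans
    (hexp (by linarith))
  have kq := (h.close q z z' hqz hqz' _ h₃ _ h₄ (S - (T - τ)) ⟨by linarith, by linarith⟩).trans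
    (hexp (by linarith))
  have kz : ∀ w : H, T ≤ dist p w → p ≠ w → q ≠ w → ∀ γ ∈ through p w, ∀ γ' ∈ through q w,
      |(∫ t in (0 : ℝ)..dist p w - τ, Φ (reverse (flow t (turn (dist p w) γ)))) -
        ∫ t in (0 : ℝ)..dist p w - τ, Φ (reverse (flow t (turn (dist q w) γ')))| ≤ C * E := by
    intro w hw hpw hqw γ hγ γ' hγ'
    have e1 := gromovProd_add p w q
    have e2 := gromovProd_le_right p w q
    exact (h.close_reverse w p q hpw.symm hqw.symm _ (turn_mem_through hγ) _
      (turn_mem_through hγ') (dist p w - τ) ⟨by linarith, by linarith⟩).trans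
      (hexp (by linarith))
  have k1 := kz z hTz hpz hqz γ₁ h₁ γ₃ h₃
  have k2 := kz z' hTz' hpz' hqz' γ₂ h₂ γ₄ h₄
  have m1 := hΦ.abs_phiDist_sub_le h.bounded h₁ τ (dist p z - τ)
  have m2 := hΦ.abs_phiDist_sub_le h.bounded h₂ τ (dist p z' - τ)
  -- The final pieces from `q` have the same lengths as those from `p`, as the comparison at `z` and
  -- `z'` requires. The mismatch thus falls on the segments from `q`: half of the difference of
  -- distances bounded in `hδ`, up to sign.
  have m3 := hΦ.abs_phiDist_sub_le h.bounded h₃ (S - (T - τ)) (dist p z - τ)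
  have m4 := hΦ.abs_phiDist_sub_le h.bounded h₄ (S - (T - τ)) (dist p z' - τ)
  rw [sub_sub_cancel, sub_self, abs_zero, mul_zero] at m1 m2
  have hδ : |(dist p z - dist q z) - (dist p z' - dist q z')| ≤ 3 * E := by
    refine (hCAT.abs_dist_quadrilateral_le (gromovProd_le_left p q z) (gromovProd_le_left p q z')
      hT.le).trans (mul_le_mul_of_nonneg_left (Real.exp_le_exp.2 ?_) (by norm_num))
    have := mul_le_mul_of_nonneg_right h.eps_le (sub_nonneg.2 hT.le)
    linarith
  have e3 : |dist q z - (dist p z - τ) - (S - (T - τ))| ≤ 3 * E / 2 := by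
    rw [hSe, abs_le]
    constructor <;> linarith [(abs_le.1 hδ).1, (abs_le.1 hδ).2]
  have e4 : |dist q z' - (dist p z' - τ) - (S - (T - τ))| ≤ 3 * E / 2 := by
    rw [hSe, abs_le]
    constructor <;> linarith [(abs_le.1 hδ).1, (abs_le.1 hδ).2]
  have n3 := abs_le.1 (m3.trans (mul_le_mul_of_nonneg_left e3 hL))
  have n4 := abs_le.1 (m4.trans (mul_le_mul_of_nonneg_left e4 hL))
  have n1 := abs_le.1 m1
  have n2 := abs_le.1 m2
  have a1 := abs_le.1 kp
  have a2 := abs_le.1 kq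
  have a3 := abs_le.1 k1
  have a4 := abs_le.1 k2
  rw [abs_le]
  constructor <;>
    linarith [n1.1, n1.2, n2.1, n2.2, n3.1, n3.2, n4.1, n4.2, a1.1, a1.2, a2.1, a2.2, a3.1, a3.2,
      a4.1, a4.2]

/-- The four point estimate, including the borderline case. -/
theorem HasIntegralBounds.abs_quadrilateral_le_of_sub_one_lt (hCAT : IsCATNegOne H)
    (hcomplete : GeodesicallyComplete H) {Φ : UnitTangent H → ℝ} (hΦ : IsTemperedHolder Φ)
    {ε C L : ℝ} (h : HasIntegralBounds Φ ε C L) {p q z z' : H}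
    (hT : dist p q - 1 < gromovProd p z z') :
    |(phiDist Φ q z - phiDist Φ p z) - (phiDist Φ q z' - phiDist Φ p z')| ≤
      (6 * C + 7 * L) * Real.exp (-(ε / 2 * (gromovProd p z z' - dist p q))) := by
  have hC := h.C_nonneg
  have hL := h.L_nonneg
  have hε := h.eps_pos
  rcases lt_or_ge (dist p q) (gromovProd p z z') with h1 | h1
  · refine (h.abs_quadrilateral_le hCAT hcomplete hΦ h1).trans
      (mul_le_mul_of_nonneg_right (by linarith) (Real.exp_pos _).le)
  have h2 : 1 ≤ Real.exp (-(ε / 2 * (gromovProd p z z' - dist p q))) :=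
    Real.one_le_exp (by nlinarith)
  refine le_trans ?_ (le_mul_of_one_le_right (by linarith) h2)
  rcases le_total (dist p q) 1 with h3 | h3
  · have k1 := abs_le.1 (h.abs_phiDist_sub_phiDist_le hcomplete hΦ h3 z)
    have k2 := abs_le.1 (h.abs_phiDist_sub_phiDist_le hcomplete hΦ h3 z')
    rw [abs_le]
    constructor <;> linarith [k1.1, k1.2, k2.1, k2.2]
  -- Stepping back by `1` to `q'` restores the strict inequality; returning to `q` costs `C + 2 * L`
  -- for each of `z` and `z'`, whence `6 * C + 7 * L`.
  · obtain ⟨q', e1, e2⟩ := hCAT.exists_point p q (t := dist p q - 1) (by linarith) (by linarith)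
    have h4 : dist q' q ≤ 1 := by linarith
    have k1 := abs_le.1 (h.abs_phiDist_sub_phiDist_le hcomplete hΦ h4 z)
    have k2 := abs_le.1 (h.abs_phiDist_sub_phiDist_le hcomplete hΦ h4 z')
    have h5 : dist p q' < gromovProd p z z' := by linarith
    have h6 : Real.exp (-(ε / 2 * (gromovProd p z z' - dist p q'))) ≤ 1 :=
      Real.exp_le_one_iff.2 (by nlinarith)
    have k3 := abs_le.1 ((h.abs_quadrilateral_le hCAT hcomplete hΦ h5).trans
      (mul_le_of_le_one_right (by linarith) h6))
    rw [abs_le]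
    constructor <;> linarith [k1.1, k1.2, k2.1, k2.2, k3.1, k3.2]

/-! ### Passage to the boundary -/

theorem tendsto_phiBusemann (hCAT : IsCATNegOne H) (hcomplete : GeodesicallyComplete H)
    (hflip : BoundedFlip H) {Φ : UnitTangent H → ℝ} (hΦ : IsTemperedHolder Φ)
    {ε C L : ℝ} (h : HasIntegralBounds Φ ε C L) (ξ : Boundary H) (p q : H) :
    Tendsto (fun z => phiDist Φ q z - phiDist Φ p z) (nhdsBoundary ξ)
      (𝓝 (phiBusemann Φ ξ p q)) := by
  have := nhdsBoundary_neBot hCAT ξ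
  refine tendsto_nhds_limUnder (CompleteSpace.complete (Metric.cauchy_iff.2
    ⟨inferInstance, fun δ hδ => ?_⟩))
  have hT := tendsto_gromovProd_self hflip p ξ
  have h1 : Tendsto (fun T : ℝ => (6 * C + 7 * L) * Real.exp (-(ε / 2 * (T - dist p q)))) atTop
      (𝓝 ((6 * C + 7 * L) * 0)) := by
    refine (Real.tendsto_exp_atBot.comp (tendsto_neg_atTop_atBot.comp ?_)).const_mul _
    exact (tendsto_atTop_add_const_right _ _ tendsto_id).const_mul_atTop (half_pos h.eps_pos)
  rw [mul_zero] at h1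
  obtain ⟨U, hU, hUU⟩ := mem_prod_same_iff.1
    ((hT.eventually_gt_atTop (dist p q - 1)).and ((h1.comp hT).eventually_lt_const hδ))
  refine ⟨_, image_mem_map hU, ?_⟩
  rintro _ ⟨z, hz, rfl⟩ _ ⟨z', hz', rfl⟩
  have k := hUU (Set.mk_mem_prod hz hz')
  rw [Real.dist_eq]
  exact (h.abs_quadrilateral_le_of_sub_one_lt hCAT hcomplete hΦ k.1).trans_lt k.2

/-- The boundary form of the four point estimate. -/
theorem abs_phiBusemann_sub_le (hCAT : IsCATNegOne H) (hcomplete : GeodesicallyComplete H)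
    (hflip : BoundedFlip H) {Φ : UnitTangent H → ℝ} (hΦ : IsTemperedHolder Φ)
    {ε C L : ℝ} (h : HasIntegralBounds Φ ε C L) {ζ ν : Boundary H} {p q : H} {T : ℝ}
    (hT : Tendsto (fun z : H × H => gromovProd p z.1 z.2) (nhdsBoundary ζ ×ˢ nhdsBoundary ν)
      (𝓝 T)) (hdT : dist p q ≤ T) :
    |phiBusemann Φ ζ p q - phiBusemann Φ ν p q| ≤
      (6 * C + 7 * L) * Real.exp (-(ε / 2 * (T - dist p q))) := by
  have := nhdsBoundary_neBot hCAT ζ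
  have := nhdsBoundary_neBot hCAT ν
  have h1 := ((tendsto_phiBusemann hCAT hcomplete hflip hΦ h ζ p q).comp
    (tendsto_fst (g := nhdsBoundary ν))).sub
    ((tendsto_phiBusemann hCAT hcomplete hflip hΦ h ν p q).comp
    (tendsto_snd (f := nhdsBoundary ζ)))
  have h2 : Continuous fun T : ℝ => (6 * C + 7 * L) * Real.exp (-(ε / 2 * (T - dist p q))) := by
    fun_prop
  refine le_of_tendsto_of_tendsto h1.abs ((h2.tendsto T).comp hT) ?_
  -- When `T = d(p,q)`, nearby products may fall below `d(p,q)`; this is why the borderline estimate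
  -- is needed.
  filter_upwards [hT.eventually_const_lt (by linarith : dist p q - 1 < T)] with z hz
  exact h.abs_quadrilateral_le_of_sub_one_lt hCAT hcomplete hΦ hz

theorem visualDist_eq (hCAT : IsCATNegOne H) {p : H} {ζ ν : Boundary H} {T : ℝ}
    (hT : Tendsto (fun z : H × H => gromovProd p z.1 z.2) (nhdsBoundary ζ ×ˢ nhdsBoundary ν)
      (𝓝 T)) : visualDist p ζ ν = Real.exp (-T) := by
  have := nhdsBoundary_neBot hCAT ζ
  have := nhdsBoundary_neBot hCAT ν
  have h : gromovProdBoundary p ζ ν = (T : EReal) :=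
    Tendsto.limUnder_eq ((continuous_coe_real_ereal.tendsto T).comp hT)
  rw [visualDist, h, ← EReal.coe_neg, EReal.exp_coe, ENNReal.toReal_ofReal (Real.exp_pos _).le]

end NegCurv

end

theorem mainTheorem5 {H : Type*} [MetricSpace H]
    (hCAT : NegCurv.IsCATNegOne H) (hcomplete : NegCurv.GeodesicallyComplete H)
    (hflip : NegCurv.BoundedFlip H)
    (Φ : NegCurv.UnitTangent H → ℝ) (hΦ : NegCurv.IsTemperedHolder Φ) :
    (∀ (ξ : NegCurv.Boundary H) (p q : H),
      Tendsto (fun z => NegCurv.phiDist Φ q z - NegCurv.phiDist Φ p z)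
        (NegCurv.nhdsBoundary ξ) (𝓝 (NegCurv.phiBusemann Φ ξ p q))) ∧
    ∃ ε : ℝ, 0 < ε ∧ ∃ D : ℝ, ∀ p q : H,
      (⨆ (ζ : NegCurv.Boundary H) (ν : NegCurv.Boundary H)
          (_ : ζ ≠ ν) (_ : NegCurv.visualDist p ζ ν ≤ Real.exp (-dist p q)),
        ENNReal.ofReal
          (|NegCurv.phiBusemann Φ ζ p q - NegCurv.phiBusemann Φ ν p q|
            / NegCurv.visualDist p ζ ν ^ ε))
      < ENNReal.ofReal (D * Real.exp (ε * dist p q)) := by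
  obtain ⟨ε, C, L, h⟩ := hΦ.exists_hasIntegralBounds hCAT hcomplete hflip
  have hC := h.C_nonneg
  have hL := h.L_nonneg
  refine ⟨NegCurv.tendsto_phiBusemann hCAT hcomplete hflip hΦ h, ε / 2, half_pos h.eps_pos,
    -- The extra `1` makes the inequality strict, also when `C = L = 0`.
    6 * C + 7 * L + 1, fun p q => ?_⟩
  refine lt_of_le_of_lt (b := ENNReal.ofReal ((6 * C + 7 * L) * Real.exp (ε / 2 * dist p q)))
    (iSup_le fun ζ => iSup_le fun ν => iSup_le fun hne => iSup_le fun hvis => ?_) ?_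
  · obtain ⟨T, hT⟩ := NegCurv.exists_tendsto_gromovProd hCAT hflip p hne
    rw [NegCurv.visualDist_eq hCAT hT] at hvis ⊢
    have hdT : dist p q ≤ T := neg_le_neg_iff.1 (Real.exp_le_exp.1 hvis)
    refine ENNReal.ofReal_le_ofReal ?_
    rw [div_le_iff₀ (Real.rpow_pos_of_pos (Real.exp_pos _) _), mul_assoc, ← Real.exp_mul,
      ← Real.exp_add]
    refine (NegCurv.abs_phiBusemann_sub_le hCAT hcomplete hflip hΦ h hT hdT).trans_eq ?_
    ring_nf
  · exact (ENNReal.ofReal_lt_ofReal_iff (by positivity)).2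
      (mul_lt_mul_of_pos_right (by linarith) (Real.exp_pos _))
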